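/- Let $n \ge 2$, and let $H^2(\mathbb{D}^n)$ be the Hardy module over the polydisc, i.e. the closure of $\mathbb{C}[z_1,\dots,z_n]$ in $L^2(\mathbb{T}^n)$ with the multiplication operators $M_{z_1},\dots,M_{z_n}$ by the coordinate functions; a submodule of it is a closed subspace invariant under every $M_{z_i}$. Let $\Theta_i,\Phi_i\in H^\infty(\mathbb{D})$ be inner functions for $i=1,\dots,n$, put $\tilde\Theta_i(\boldsymbol z)=\Theta_i(z_i)$ and $\tilde\Phi_i(\boldsymbol z)=\Phi_i(z_i)$, and let $$\mathcal{S}_\Theta=\sum_{i=1}^n\tilde\Theta_i H^2(\mathbb{D}^n),\qquad \mathcal{S}_\Phi=\sum_{i=1}^n\tilde\Phi_i H^2(\mathbb{D}^n).$$ Then $\mathcal{S}_\Theta$ and $\mathcal{S}_\Phi$ are submodules of $H^2(\mathbb{D}^n)$, and they are unitarily equivalent (that is, there is a unitary map $U:\mathcal{S}_\Theta\to\mathcal{S}_\Phi$ with $U(M_{z_i}|_{\mathcal{S}_\Theta})=(M_{z_i}|_{\mathcal{S}_\Phi})U$ for all $i=1,\dots,n$) if and only if $\mathcal{S}_\Theta=\mathcal{S}_\Phi$.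 -/

import Mathlib

open MeasureTheory Filter Topology

noncomputable section

namespace HardyPolydisc

/-- Normalized Haar (Lebesgue) measure on the torus `𝕋ⁿ`; a point `t` of `UnitAddTorus (Fin n)`
stands for the point of `𝕋ⁿ` with coordinates `AddCircle.toCircle (t i) = exp (2 π i tᵢ)`. -/
abbrev torusMeasure (n : ℕ) : Measure (UnitAddTorus (Fin n)) :=
  Measure.pi fun _ => AddCircle.haarAddCircle

/-- The Hilbert space `L²(𝕋ⁿ)`. -/
abbrev L2 (n : ℕ) : Type := Lp ℂ 2 (torusMeasure n)

/-- The monomial `z₁ ^ k₁ ⋯ zₙ ^ kₙ` as an element of `L²(𝕋ⁿ)`. -/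
def monomial {n : ℕ} (k : Fin n → ℕ) : L2 n :=
  ContinuousMap.toLp (E := ℂ) 2 (torusMeasure n) ℂ (UnitAddTorus.mFourier fun i => (k i : ℤ))

/-- The Hardy space `H²(𝔻ⁿ)`: the closure of `ℂ[z₁, …, zₙ]` in `L²(𝕋ⁿ)`. -/
def hardySpace (n : ℕ) : Submodule ℂ (L2 n) :=
  (Submodule.span ℂ (Set.range (monomial (n := n)))).topologicalClosure

lemma memLp_coord_mul {n : ℕ} (i : Fin n) (f : L2 n) :
    MemLp (fun t => (AddCircle.toCircle (t i) : ℂ) * f t) 2 (torusMeasure n) := by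
  refine (Lp.memLp f).of_le ?_ (ae_of_all _ fun t => by
    rw [norm_mul, Circle.norm_coe, one_mul])
  refine AEStronglyMeasurable.mul ?_ (Lp.aestronglyMeasurable f)
  have h : Continuous fun t : UnitAddTorus (Fin n) => (AddCircle.toCircle (t i) : ℂ) :=
    continuous_subtype_val.comp (AddCircle.continuous_toCircle.comp (continuous_apply i))
  exact h.aestronglyMeasurable

/-- Multiplication by the coordinate function `zᵢ` on `L²(𝕋ⁿ)`. -/
def coordMul {n : ℕ} (i : Fin n) : L2 n →ₗ[ℂ] L2 n where
  toFun f := (memLp_coord_mul i f).toLp _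
  map_add' f g := by
    refine Lp.ext ?_
    filter_upwards [(memLp_coord_mul i (f + g)).coeFn_toLp, (memLp_coord_mul i f).coeFn_toLp,
      (memLp_coord_mul i g).coeFn_toLp, Lp.coeFn_add f g,
      Lp.coeFn_add ((memLp_coord_mul i f).toLp _) ((memLp_coord_mul i g).toLp _)]
      with t h1 h2 h3 h4 h5
    rw [h1, h5, Pi.add_apply, h2, h3, h4, Pi.add_apply, mul_add]
  map_smul' c f := by
    refine Lp.ext ?_
    filter_upwards [(memLp_coord_mul i (c • f)).coeFn_toLp, (memLp_coord_mul i f).coeFn_toLp,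
      Lp.coeFn_smul c f, Lp.coeFn_smul c ((memLp_coord_mul i f).toLp _)] with t h1 h2 h3 h4
    rw [RingHom.id_apply, h1, h4, Pi.smul_apply, h2, h3, Pi.smul_apply, smul_eq_mul, smul_eq_mul,
      mul_left_comm]

/-- A submodule of the Hardy module `H²(𝔻ⁿ)`: a closed subspace of `H²(𝔻ⁿ)` which is invariant
under multiplication by every coordinate function. -/
structure IsHardySubmodule {n : ℕ} (S : Submodule ℂ (L2 n)) : Prop where
  le_hardySpace : S ≤ hardySpace n
  isClosed : IsClosed (S : Set (L2 n))
  coordMul_mem : ∀ i, ∀ f ∈ S, coordMul i f ∈ S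

/-- Unitary equivalence: there is a unitary map `U : S₁ → S₂` with
`U (M_{zᵢ}|_{S₁}) = (M_{zᵢ}|_{S₂}) U` for all `i`. Here `g : S₁` with `g = zᵢ f` is
`M_{zᵢ}|_{S₁} f`. -/
def UnitarilyEquivalent {n : ℕ} (S₁ S₂ : Submodule ℂ (L2 n)) : Prop :=
  ∃ U : S₁ ≃ₗᵢ[ℂ] S₂, ∀ (i : Fin n) (f g : S₁),
    (g : L2 n) = coordMul i (f : L2 n) → (U g : L2 n) = coordMul i (U f : L2 n)

/-- An inner function on the unit disc: a bounded holomorphic function whose radial limits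
`lim_{r → 1⁻} θ (r ζ)` exist and have modulus one for almost every `ζ ∈ 𝕋`. -/
structure IsInner (θ : ℂ → ℂ) : Prop where
  differentiableOn : DifferentiableOn ℂ θ (Metric.ball 0 1)
  bounded : ∃ C : ℝ, ∀ z ∈ Metric.ball (0 : ℂ) 1, ‖θ z‖ ≤ C
  radial : ∀ᵐ t : UnitAddCircle ∂AddCircle.haarAddCircle, ∃ w : ℂ, ‖w‖ = 1 ∧
    Tendsto (fun r : ℝ => θ (r * (AddCircle.toCircle t : ℂ))) (𝓝[<] 1) (𝓝 w)

/-- The boundary function of `θ` on `𝕋`, given by radial limits. -/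
def boundaryValue (θ : ℂ → ℂ) (t : UnitAddCircle) : ℂ :=
  limUnder (𝓝[<] (1 : ℝ)) fun r : ℝ => θ (r * (AddCircle.toCircle t : ℂ))

/-- The space `θ̃ H²(𝔻ⁿ)`, where `θ̃(z) = θ(zᵢ)`. -/
def innerMultiples {n : ℕ} (θ : ℂ → ℂ) (i : Fin n) : Submodule ℂ (L2 n) where
  carrier := {f | ∃ h ∈ hardySpace n,
    f =ᵐ[torusMeasure n] fun t => boundaryValue θ (t i) * h t}
  add_mem' := by
    rintro f g ⟨h, hh, hf⟩ ⟨k, hk, hg⟩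
    refine ⟨h + k, add_mem hh hk, ?_⟩
    filter_upwards [hf, hg, Lp.coeFn_add f g, Lp.coeFn_add h k] with t h1 h2 h3 h4
    rw [h3, h4, Pi.add_apply, Pi.add_apply, h1, h2, mul_add]
  zero_mem' := by
    refine ⟨0, zero_mem _, ?_⟩
    filter_upwards [Lp.coeFn_zero ℂ 2 (torusMeasure n)] with t h1
    rw [h1, Pi.zero_apply, mul_zero]
  smul_mem' := by
    rintro c f ⟨h, hh, hf⟩
    refine ⟨c • h, Submodule.smul_mem _ c hh, ?_⟩
    filter_upwards [hf, Lp.coeFn_smul c f, Lp.coeFn_smul c h] with t h1 h2 h3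
    rw [h2, h3, Pi.smul_apply, Pi.smul_apply, h1, smul_eq_mul, smul_eq_mul, mul_left_comm]

/-- The (algebraic) sum `∑ᵢ Θ̃ᵢ H²(𝔻ⁿ)`, where `Θ̃ᵢ(z) = Θᵢ(zᵢ)`. -/
def innerSum {n : ℕ} (Θ : Fin n → ℂ → ℂ) : Submodule ℂ (L2 n) :=
  ⨆ i, innerMultiples (Θ i) i

end HardyPolydisc

end

/-! Closedness. Let `P` be the projection onto H². Each Θᵢ(zᵢ)H² is the range of the idempotent Θᵢ P
Θ̄ᵢ P (`innerProj`). Multiplication by a function of zᵢ moves only the i-th Fourier index, so for i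
≠ j the operators P Θ̄ᵢ and Θⱼ commute on H² (`starProjection_innerMulConj_innerMul`). Hence the
idempotents commute, and the sum of their ranges is the kernel of ∏ (1 - Pᵢ), a closed space
(`isClosed_iSup_range_of_commute`).

Rigidity. A unitary module map U preserves every inner product ⟨z^b g, z^a f⟩, that is, every
Fourier coefficient of g̅ f; so g̅ f and the same product formed from Ug and Uf agree almost
everywhere (`conj_mul_ae_eq_of_unitary`). With g = Θⱼ(zⱼ) this makes U multiplication by the
unimodular function φ = Θ̄ⱼ UΘⱼ, which does not depend on j. The factor Θ̄ⱼ(zⱼ) can create negative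
frequencies only in direction j; as n ≥ 2, every direction i is spared by some j ≠ i, so φ ∈ H²
(`exists_multiplier`). The inverse of U has multiplier φ̅, which lies in H² for the same reason.
Therefore φ is constant (`eq_smul_character_zero`), U is a scalar, and the two spaces coincide. -/

noncomputable section

namespace HardyPolydisc

open scoped ComplexConjugate

/-! ### Fourier series on the torus and the Hardy space. -/

section Fourier

variable {n : ℕ}

/-- The character `z ^ k`, `k ∈ ℤⁿ`, as an element of `L²(𝕋ⁿ)`. -/
def character (k : Fin n → ℤ) : L2 n :=
  ContinuousMap.toLp (E := ℂ) 2 (torusMeasure n) ℂ (UnitAddTorus.mFourier k)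

lemma coeFn_character (k : Fin n → ℤ) :
    character k =ᵐ[torusMeasure n] UnitAddTorus.mFourier k :=
  ContinuousMap.coeFn_toLp _ _

/-- The characters as a Hilbert basis of `L²(𝕋ⁿ)`. -/
def characterBasis (n : ℕ) : HilbertBasis (Fin n → ℤ) ℂ (L2 n) :=
  UnitAddTorus.mFourierBasis

lemma characterBasis_apply (k : Fin n → ℤ) : characterBasis n k = character k :=
  congrFun UnitAddTorus.coe_mFourierBasis k

/-- The Fourier coefficient at `k`. -/
def coeff (k : Fin n → ℤ) : L2 n →L[ℂ] ℂ := innerSL ℂ (character k)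

lemma coeff_apply (k : Fin n → ℤ) (f : L2 n) : coeff k f = inner ℂ (character k) f := rfl

lemma coeff_eq_integral (k : Fin n → ℤ) (f : L2 n) :
    coeff k f = ∫ t, conj (UnitAddTorus.mFourier k t) * f t ∂torusMeasure n := by
  rw [coeff_apply, L2.inner_def]
  refine integral_congr_ae ?_
  filter_upwards [coeFn_character k] with t ht
  rw [ht, RCLike.inner_apply, mul_comm]

lemma hasSum_coeff_smul (f : L2 n) : HasSum (fun k => coeff k f • character k) f := by
  have h := (characterBasis n).hasSum_repr f
  simpa only [HilbertBasis.repr_apply_apply, characterBasis_apply, ← coeff_apply] using h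

lemma ext_coeff {f g : L2 n} (h : ∀ k, coeff k f = coeff k g) : f = g := by
  refine (hasSum_coeff_smul f).unique ?_
  simp_rw [h]
  exact hasSum_coeff_smul g

lemma coeff_character (k l : Fin n → ℤ) :
    coeff k (character l) = if k = l then 1 else 0 := by
  rw [coeff_apply, ← characterBasis_apply, ← characterBasis_apply]
  exact orthonormal_iff_ite.1 (characterBasis n).orthonormal k l

lemma inner_eq_zero_of_coeff (f g : L2 n) (h : ∀ k, coeff k f = 0 ∨ coeff k g = 0) :
    inner ℂ f g = 0 := by
  refine ((characterBasis n).hasSum_inner_mul_inner f g).unique ?_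
  convert hasSum_zero with k
  rw [characterBasis_apply, ← inner_conj_symm, ← coeff_apply, ← coeff_apply]
  rcases h k with h | h <;> simp [h]

lemma isClosed_hardySpace : IsClosed (hardySpace n : Set (L2 n)) :=
  Submodule.isClosed_topologicalClosure _

/-- Membership in the Hardy space in terms of Fourier coefficients. -/
lemma mem_hardySpace_iff {f : L2 n} :
    f ∈ hardySpace n ↔ ∀ k : Fin n → ℤ, (∃ i, k i < 0) → coeff k f = 0 := by
  constructor
  · rintro hf k ⟨i, hi⟩
    have hle : hardySpace n ≤ LinearMap.ker (coeff k).toLinearMap := by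
      refine Submodule.topologicalClosure_minimal _ ?_ (coeff k).isClosed_ker
      rw [Submodule.span_le]
      rintro _ ⟨l, rfl⟩
      refine (coeff_character k _).trans (if_neg ?_)
      rintro rfl
      exact absurd hi (by simp)
    exact hle hf
  · intro h
    -- The partial sums of the Fourier series already lie in the closed space, since only monomials
    -- with nonnegative exponents survive.
    refine isClosed_hardySpace.mem_of_tendsto (hasSum_coeff_smul f) (Eventually.of_forall fun s => ?_)
    refine Submodule.sum_mem _ fun k _ => ?_
    by_cases hk : ∃ i, k i < 0
    · rw [h k hk, zero_smul]
      exact zero_mem _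
    · push Not at hk
      refine Submodule.smul_mem _ _ (Submodule.le_topologicalClosure _ (Submodule.subset_span ?_))
      refine ⟨fun i => (k i).toNat, ?_⟩
      have : (fun i => ((k i).toNat : ℤ)) = k := funext fun i => Int.toNat_of_nonneg (hk i)
      rw [monomial, this, character]

instance : CompleteSpace (hardySpace n) := isClosed_hardySpace.completeSpace_coe

lemma starProjection_hardySpace_eq_zero {f : L2 n}
    (h : ∀ k : Fin n → ℤ, (∀ i, 0 ≤ k i) → coeff k f = 0) :
    (hardySpace n).starProjection f = 0 := by
  rw [Submodule.starProjection_apply_eq_zero_iff, Submodule.mem_orthogonal]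
  intro g hg
  refine inner_eq_zero_of_coeff g f fun k => ?_
  by_cases hk : ∃ i, k i < 0
  · exact Or.inl (mem_hardySpace_iff.1 hg k hk)
  · push Not at hk
    exact Or.inr (h k hk)

end Fourier

/-! ### Multiplication by unimodular functions. -/

section Multiplication

variable {α : Type*} [MeasurableSpace α]

/-- An almost everywhere unimodular measurable function. -/
structure IsUnimodular (μ : Measure α) (ψ : α → ℂ) : Prop where
  aestronglyMeasurable : AEStronglyMeasurable ψ μ
  norm_eq_one : ∀ᵐ t ∂μ, ‖ψ t‖ = 1

variable {μ : Measure α} {ψ χ : α → ℂ}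

lemma IsUnimodular.conj (hψ : IsUnimodular μ ψ) : IsUnimodular μ fun t => conj (ψ t) where
  aestronglyMeasurable := Complex.continuous_conj.comp_aestronglyMeasurable hψ.1
  norm_eq_one := by
    filter_upwards [hψ.2] with t ht
    rwa [RCLike.norm_conj]

lemma IsUnimodular.memLp_mul (hψ : IsUnimodular μ ψ) (f : Lp ℂ 2 μ) :
    MemLp (fun t => ψ t * f t) 2 μ := by
  refine (Lp.memLp f).of_le (hψ.1.mul (Lp.aestronglyMeasurable f)) ?_
  filter_upwards [hψ.2] with t ht
  rw [norm_mul, ht, one_mul]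

/-- Multiplication by a unimodular function on `L²`. -/
def mulOp (hψ : IsUnimodular μ ψ) : Lp ℂ 2 μ →L[ℂ] Lp ℂ 2 μ :=
  LinearMap.mkContinuous
    { toFun := fun f => (hψ.memLp_mul f).toLp _
      map_add' := fun f g => by
        refine Lp.ext ?_
        filter_upwards [(hψ.memLp_mul (f + g)).coeFn_toLp, (hψ.memLp_mul f).coeFn_toLp,
          (hψ.memLp_mul g).coeFn_toLp, Lp.coeFn_add f g,
          Lp.coeFn_add ((hψ.memLp_mul f).toLp _) ((hψ.memLp_mul g).toLp _)]
          with t h1 h2 h3 h4 h5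
        rw [h1, h5, Pi.add_apply, h2, h3, h4, Pi.add_apply, mul_add]
      map_smul' := fun c f => by
        refine Lp.ext ?_
        filter_upwards [(hψ.memLp_mul (c • f)).coeFn_toLp, (hψ.memLp_mul f).coeFn_toLp,
          Lp.coeFn_smul c f, Lp.coeFn_smul c ((hψ.memLp_mul f).toLp _)] with t h1 h2 h3 h4
        rw [RingHom.id_apply, h1, h4, Pi.smul_apply, h2, h3, Pi.smul_apply, smul_eq_mul,
          smul_eq_mul, mul_left_comm] }
    1 fun f => by
      rw [one_mul]
      refine Lp.norm_le_norm_of_ae_le ?_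
      filter_upwards [(hψ.memLp_mul f).coeFn_toLp, hψ.2] with t h1 h2
      exact le_of_eq ((congrArg norm h1).trans (by rw [norm_mul, h2, one_mul]))

lemma coeFn_mulOp (hψ : IsUnimodular μ ψ) (f : Lp ℂ 2 μ) :
    mulOp hψ f =ᵐ[μ] fun t => ψ t * f t :=
  (hψ.memLp_mul f).coeFn_toLp

lemma mulOp_comm (hψ : IsUnimodular μ ψ) (hχ : IsUnimodular μ χ) (f : Lp ℂ 2 μ) :
    mulOp hψ (mulOp hχ f) = mulOp hχ (mulOp hψ f) := by
  refine Lp.ext ?_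
  filter_upwards [coeFn_mulOp hψ (mulOp hχ f), coeFn_mulOp hχ (mulOp hψ f), coeFn_mulOp hψ f,
    coeFn_mulOp hχ f] with t h1 h2 h3 h4
  rw [h1, h2, h3, h4, mul_left_comm]

lemma mulOp_conj_mulOp (hψ : IsUnimodular μ ψ) (f : Lp ℂ 2 μ) :
    mulOp hψ.conj (mulOp hψ f) = f := by
  refine Lp.ext ?_
  filter_upwards [coeFn_mulOp hψ.conj (mulOp hψ f), coeFn_mulOp hψ f, hψ.2] with t h1 h2 h3
  rw [h1, h2, ← mul_assoc, ← Complex.normSq_eq_conj_mul_self, Complex.normSq_eq_norm_sq, h3]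
  simp

lemma inner_mulOp_right (hψ : IsUnimodular μ ψ) (f g : Lp ℂ 2 μ) :
    inner ℂ f (mulOp hψ g) = inner ℂ (mulOp hψ.conj f) g := by
  rw [L2.inner_def, L2.inner_def]
  refine integral_congr_ae ?_
  filter_upwards [coeFn_mulOp hψ g, coeFn_mulOp hψ.conj f] with t h1 h2
  rw [h1, h2, RCLike.inner_apply, RCLike.inner_apply, map_mul, Complex.conj_conj]
  ring

end Multiplication

/-! ### Multiplication by a function of one coordinate. -/

section CoordinateMultiplication

variable {n : ℕ} {ψ : UnitAddCircle → ℂ}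

lemma IsUnimodular.comp_eval (hψ : IsUnimodular AddCircle.haarAddCircle ψ) (i : Fin n) :
    IsUnimodular (torusMeasure n) fun t => ψ (t i) := by
  have h : MeasurePreserving (Function.eval i) (torusMeasure n) AddCircle.haarAddCircle :=
    measurePreserving_eval (fun _ : Fin n => AddCircle.haarAddCircle) i
  exact ⟨hψ.1.comp_measurePreserving h, h.quasiMeasurePreserving.ae hψ.2⟩

/-- The integrand is a product of one-variable functions, so Fubini applies: the factor at `j` gives
a Fourier coefficient of `ψ`, and orthonormality turns every other factor into a Kronecker delta. -/
lemma coeff_mulOp_comp_eval_character (hψ : IsUnimodular AddCircle.haarAddCircle ψ) (j : Fin n)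
    (k l : Fin n → ℤ) :
    coeff l (mulOp (hψ.comp_eval j) (character k)) =
      if ∀ i, i ≠ j → l i = k i then fourierCoeff ψ (l j - k j) else 0 := by
  classical
  have h1 : coeff l (mulOp (hψ.comp_eval j) (character k)) =
      ∫ t : UnitAddTorus (Fin n), ∏ i, (if i = j then ψ (t i) else 1) *
        (fourier (-(l i - k i)) (t i) : ℂ) ∂torusMeasure n := by
    rw [coeff_eq_integral]
    refine integral_congr_ae ?_
    filter_upwards [coeFn_mulOp (hψ.comp_eval j) (character k), coeFn_character k] with t h1 h2
    rw [h1, h2, Finset.prod_mul_distrib, Finset.prod_ite_eq' Finset.univ j (fun i => ψ (t i)),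
      if_pos (Finset.mem_univ j), ← UnitAddTorus.mFourier_neg, mul_left_comm,
      ← UnitAddTorus.mFourier_add]
    refine congrArg (ψ (t j) * ·) ?_
    rw [UnitAddTorus.mFourier, ContinuousMap.coe_mk]
    refine Finset.prod_congr rfl fun i _ => ?_
    rw [Pi.add_apply, Pi.neg_apply, neg_sub, neg_add_eq_sub]
  have h2 := integral_fintype_prod_eq_prod (μ := fun _ : Fin n => AddCircle.haarAddCircle)
    (fun i (s : UnitAddCircle) => (if i = j then ψ s else 1) * (fourier (-(l i - k i)) s : ℂ))
  rw [h1]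
  refine h2.trans ?_
  have h3 : ∀ i, i ≠ j → ∫ s : UnitAddCircle, (if i = j then ψ s else 1) *
      (fourier (-(l i - k i)) s : ℂ) ∂AddCircle.haarAddCircle = if l i = k i then 1 else 0 := by
    intro i hi
    have := orthonormal_iff_ite.1 (orthonormal_fourier (T := 1)) (l i) (k i)
    rw [← this, ContinuousMap.inner_toLp]
    refine integral_congr_ae (ae_of_all _ fun s => ?_)
    simp only [if_neg hi, one_mul]
    rw [← fourier_neg, ← fourier_add, neg_sub, sub_eq_add_neg]
  rw [← Finset.mul_prod_erase _ _ (Finset.mem_univ j),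
    Finset.prod_congr rfl fun i hi => h3 i (Finset.ne_of_mem_erase hi)]
  by_cases h : ∀ i, i ≠ j → l i = k i
  · rw [if_pos h, Finset.prod_eq_one fun i hi => if_pos (h i (Finset.ne_of_mem_erase hi)), mul_one,
      fourierCoeff]
    refine integral_congr_ae (ae_of_all _ fun s => ?_)
    simp only [if_true, smul_eq_mul, mul_comm]
  · rw [if_neg h]
    push Not at h
    obtain ⟨i, hij, hi⟩ := h
    rw [Finset.prod_eq_zero (Finset.mem_erase.2 ⟨hij, Finset.mem_univ i⟩) (if_neg hi), mul_zero]

lemma fourierCoeff_conj (ψ : UnitAddCircle → ℂ) (m : ℤ) :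
    fourierCoeff (fun s => conj (ψ s)) m = conj (fourierCoeff ψ (-m)) := by
  rw [fourierCoeff, fourierCoeff, ← integral_conj]
  refine integral_congr_ae (ae_of_all _ fun s => ?_)
  simp only [smul_eq_mul, map_mul, neg_neg]
  rw [← fourier_neg]

/-- A Fourier coefficient of `ψ(zⱼ) f` vanishes as soon as every term of the convolution sum
defining it vanishes. -/
lemma coeff_mulOp_comp_eval_eq_zero (hψ : IsUnimodular AddCircle.haarAddCircle ψ) (j : Fin n)
    (f : L2 n) (k : Fin n → ℤ)
    (h : ∀ l : Fin n → ℤ, (∀ i, i ≠ j → l i = k i) →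
      fourierCoeff ψ (k j - l j) = 0 ∨ coeff l f = 0) :
    coeff k (mulOp (hψ.comp_eval j) f) = 0 := by
  -- On the other side of the inner product stands ψ̄(zⱼ) z^k, whose spectrum lies on the line
  -- through `k` in direction `j`.
  rw [coeff_apply, inner_mulOp_right]
  refine inner_eq_zero_of_coeff _ _ fun l => ?_
  have := coeff_mulOp_comp_eval_character hψ.conj j k l
  rw [fourierCoeff_conj, neg_sub] at this
  rw [this]
  split_ifs with hl
  · exact (h l hl).imp_left fun h => by rw [h, map_zero]
  · exact Or.inl rfl

end CoordinateMultiplication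

/-! ### Uniqueness of Fourier coefficients of integrable functions. -/

section Uniqueness

/-- An integrable function on a compact metrizable space whose integral against every continuous
function vanishes is zero almost everywhere. -/
lemma ae_eq_zero_of_forall_integral_continuousMap_mul_eq_zero {X : Type*} [TopologicalSpace X]
    [CompactSpace X] [HasOuterApproxClosed X] [MeasurableSpace X] [BorelSpace X] {μ : Measure X}
    {h : X → ℂ} (hh : Integrable h μ) (h0 : ∀ c : C(X, ℂ), ∫ t, c t * h t ∂μ = 0) :
    h =ᵐ[μ] 0 := by
  refine ae_eq_zero_of_forall_setIntegral_isClosed_eq_zero hh fun s hs => ?_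
  let c : ℕ → C(X, ℂ) := fun m =>
    ⟨fun t => ((hs.apprSeq m t : ℝ) : ℂ), by fun_prop⟩
  have hlim : Tendsto (fun m => ∫ t, c m t * h t ∂μ) atTop (𝓝 (∫ t, s.indicator h t ∂μ)) := by
    refine tendsto_integral_of_dominated_convergence (fun t => ‖h t‖)
      (fun m => (c m).continuous.aestronglyMeasurable.mul hh.1) hh.norm
      (fun m => ae_of_all _ fun t => ?_) (ae_of_all _ fun t => ?_)
    · rw [norm_mul]
      refine mul_le_of_le_one_left (norm_nonneg _) ?_
      have : (hs.apprSeq m t : ℝ) ≤ 1 := by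
        exact_mod_cast HasOuterApproxClosed.apprSeq_apply_le_one hs m t
      simpa [c] using this
    · have h1 := tendsto_pi_nhds.1 (HasOuterApproxClosed.tendsto_apprSeq hs) t
      have h2 : Tendsto (fun m => c m t) atTop
          (𝓝 (((s.indicator (fun _ => (1 : NNReal)) t : NNReal) : ℝ) : ℂ)) :=
        (Complex.continuous_ofReal.tendsto _).comp ((NNReal.continuous_coe.tendsto _).comp h1)
      have h3 : s.indicator h t =
          (((s.indicator (fun _ => (1 : NNReal)) t : NNReal) : ℝ) : ℂ) * h t := by
        by_cases ht : t ∈ s <;> simp [ht]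
      rw [h3]
      exact h2.mul_const _
  rw [← integral_indicator hs.measurableSet]
  refine tendsto_nhds_unique hlim ?_
  simp_rw [h0]
  exact tendsto_const_nhds

/-- Fourier uniqueness in `L¹(𝕋ⁿ)`. -/
lemma ae_eq_of_integral_mFourier_mul_eq {n : ℕ} {g h : UnitAddTorus (Fin n) → ℂ}
    (hg : Integrable g (torusMeasure n)) (hh : Integrable h (torusMeasure n))
    (heq : ∀ k, ∫ t, UnitAddTorus.mFourier k t * g t ∂torusMeasure n =
      ∫ t, UnitAddTorus.mFourier k t * h t ∂torusMeasure n) :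
    g =ᵐ[torusMeasure n] h := by
  have hint : ∀ c : C(UnitAddTorus (Fin n), ℂ), ∀ f, Integrable f (torusMeasure n) →
      Integrable (fun t => c t * f t) (torusMeasure n) := fun c f hf =>
    hf.bdd_mul c.continuous.aestronglyMeasurable (ae_of_all _ fun t => c.norm_coe_le_norm t)
  have hgh := hg.sub hh
  -- Integration against `g - h` is continuous for the sup norm and kills the characters, whose span
  -- is dense in the continuous functions.
  let I : C(UnitAddTorus (Fin n), ℂ) →L[ℂ] ℂ := LinearMap.mkContinuous
    { toFun := fun c => ∫ t, c t * (g - h) t ∂torusMeasure n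
      map_add' := fun c d => by
        rw [← integral_add (hint c _ hgh) (hint d _ hgh)]
        simp only [ContinuousMap.add_apply, add_mul]
      map_smul' := fun a c => by
        rw [RingHom.id_apply, smul_eq_mul, ← integral_const_mul]
        simp only [ContinuousMap.smul_apply, smul_eq_mul, mul_assoc] }
    (∫ t, ‖(g - h) t‖ ∂torusMeasure n) fun c => by
      refine (norm_integral_le_integral_norm _).trans ?_
      rw [← integral_mul_const]
      refine integral_mono (hint c _ hgh).norm (hgh.norm.mul_const _) fun t => ?_
      simp only [norm_mul]
      rw [mul_comm]
      exact mul_le_mul_of_nonneg_left (c.norm_coe_le_norm t) (norm_nonneg _)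
  have hI : (⊤ : Submodule ℂ C(UnitAddTorus (Fin n), ℂ)) ≤ LinearMap.ker I.toLinearMap := by
    rw [← UnitAddTorus.span_mFourier_closure_eq_top]
    refine Submodule.topologicalClosure_minimal _ ?_ I.isClosed_ker
    rw [Submodule.span_le]
    rintro _ ⟨k, rfl⟩
    change ∫ t, UnitAddTorus.mFourier k t * (g - h) t ∂torusMeasure n = 0
    simp only [Pi.sub_apply, mul_sub]
    rw [integral_sub (hint _ _ hg) (hint _ _ hh), heq, sub_self]
  rw [← sub_ae_eq_zero]
  exact ae_eq_zero_of_forall_integral_continuousMap_mul_eq_zero hgh fun c =>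
    hI (Submodule.mem_top (x := c))

end Uniqueness

/-! ### Boundary values of inner functions. -/

section Inner

variable {θ : ℂ → ℂ}

lemma IsInner.tendsto_boundaryValue (hθ : IsInner θ) :
    ∀ᵐ t : UnitAddCircle ∂AddCircle.haarAddCircle,
      Tendsto (fun r : ℝ => θ (r * (AddCircle.toCircle t : ℂ))) (𝓝[<] 1)
        (𝓝 (boundaryValue θ t)) ∧ ‖boundaryValue θ t‖ = 1 := by
  filter_upwards [hθ.radial] with t ht
  obtain ⟨w, hw, h⟩ := ht
  have : boundaryValue θ t = w := h.limUnder_eq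
  rw [this]
  exact ⟨h, hw⟩

lemma mul_toCircle_mem_ball {r : ℝ} (h0 : 0 ≤ r) (h1 : r < 1) (t : UnitAddCircle) :
    (r * (AddCircle.toCircle t : ℂ)) ∈ Metric.ball (0 : ℂ) 1 := by
  rw [mem_ball_zero_iff, norm_mul, Circle.norm_coe, mul_one, Complex.norm_real, Real.norm_eq_abs,
    abs_of_nonneg h0]
  exact h1

lemma IsInner.continuous_dilate (hθ : IsInner θ) {r : ℝ} (h0 : 0 ≤ r) (h1 : r < 1) :
    Continuous fun t : UnitAddCircle => θ (r * (AddCircle.toCircle t : ℂ)) := by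
  refine hθ.differentiableOn.continuousOn.comp_continuous ?_ (mul_toCircle_mem_ball h0 h1)
  exact continuous_const.mul (continuous_subtype_val.comp AddCircle.continuous_toCircle)

lemma eventually_nhdsLT_one : ∀ᶠ r : ℝ in 𝓝[<] 1, 0 < r ∧ r < 1 :=
  Ioo_mem_nhdsLT one_pos

lemma IsInner.isUnimodular (hθ : IsInner θ) :
    IsUnimodular AddCircle.haarAddCircle (boundaryValue θ) where
  aestronglyMeasurable := by
    -- Measurability passes to limits of sequences, so the radial limit is taken along a sequence of
    -- radii increasing to 1.
    obtain ⟨u, -, hu, hu1⟩ := exists_seq_strictMono_tendsto' (zero_lt_one' ℝ)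
    have hmem : ∀ m, 0 ≤ u m ∧ u m < 1 := fun m => ⟨(hu m).1.le, (hu m).2⟩
    refine aestronglyMeasurable_of_tendsto_ae atTop
      (f := fun m t => θ (u m * (AddCircle.toCircle t : ℂ)))
      (fun m => (hθ.continuous_dilate (hmem m).1 (hmem m).2).aestronglyMeasurable) ?_
    filter_upwards [hθ.tendsto_boundaryValue] with t ht
    exact ht.1.comp (tendsto_nhdsWithin_iff.2 ⟨hu1, Eventually.of_forall fun m => (hu m).2⟩)
  norm_eq_one := hθ.tendsto_boundaryValue.mono fun _ h => h.2

lemma integral_toCircle_eq_circleAverage (f : ℂ → ℂ) (r : ℝ) :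
    ∫ t : UnitAddCircle, f (r * (AddCircle.toCircle t : ℂ)) ∂AddCircle.haarAddCircle =
      Real.circleAverage f 0 r := by
  rw [AddCircle.integral_haarAddCircle, inv_one, one_smul,
    ← UnitAddCircle.intervalIntegral_preimage 0, Real.circleAverage_def]
  have h := intervalIntegral.smul_integral_comp_mul_left (a := 0) (b := 1)
    (fun s => f (circleMap 0 r s)) (2 * Real.pi)
  rw [mul_zero, mul_one] at h
  rw [← h, smul_smul, inv_mul_cancel₀ Real.two_pi_pos.ne', one_smul, zero_add]
  refine intervalIntegral.integral_congr fun s _ => ?_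
  simp only [circleMap, zero_add]
  rw [AddCircle.toCircle_apply_mk, Circle.coe_exp, div_one]

/-- The boundary function of an inner function has no negative Fourier coefficients. -/
lemma IsInner.fourierCoeff_eq_zero (hθ : IsInner θ) {m : ℤ} (hm : m < 0) :
    fourierCoeff (boundaryValue θ) m = 0 := by
  obtain ⟨p, hp, rfl⟩ : ∃ p : ℕ, p ≠ 0 ∧ m = -(p : ℤ) :=
    ⟨m.natAbs, by omega, by omega⟩
  obtain ⟨C, hC⟩ := hθ.bounded
  have hlim : Tendsto (fun r : ℝ => ∫ t : UnitAddCircle, (fourier (p : ℤ) t : ℂ) •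
      θ (r * (AddCircle.toCircle t : ℂ)) ∂AddCircle.haarAddCircle) (𝓝[<] 1)
      (𝓝 (fourierCoeff (boundaryValue θ) (-(p : ℤ)))) := by
    rw [fourierCoeff, neg_neg]
    refine tendsto_integral_filter_of_dominated_convergence (fun _ => C) ?_ ?_
      (integrable_const _) ?_
    · filter_upwards [eventually_nhdsLT_one] with r hr
      exact ((fourier (p : ℤ)).continuous.smul
        (hθ.continuous_dilate hr.1.le hr.2)).aestronglyMeasurable
    · filter_upwards [eventually_nhdsLT_one] with r hr
      refine ae_of_all _ fun t => ?_
      rw [norm_smul, fourier_apply, Circle.norm_coe, one_mul]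
      exact hC _ (mul_toCircle_mem_ball hr.1.le hr.2 t)
    · filter_upwards [hθ.tendsto_boundaryValue] with t ht
      exact ht.1.const_smul _
  refine tendsto_nhds_unique hlim (tendsto_const_nhds.congr' ?_)
  filter_upwards [eventually_nhdsLT_one] with r hr
  have hd : DifferentiableOn ℂ (fun z => z ^ p * θ z) (Metric.ball 0 1) :=
    (differentiableOn_pow p).mul hθ.differentiableOn
  -- Mean value property: z^p θ vanishes at 0 because p ≠ 0. On the circle of radius r its average
  -- is r^p times the integral in question.
  have havg : Real.circleAverage (fun z => z ^ p * θ z) 0 r = 0 := by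
    have h := DiffContOnCl.circleAverage (f := fun z => z ^ p * θ z) (c := 0) (R := r)
      (DifferentiableOn.diffContOnCl (hd.mono ?_))
    · rw [h, zero_pow hp, zero_mul]
    · refine Metric.closure_ball_subset_closedBall.trans (Metric.closedBall_subset_ball ?_)
      rw [abs_of_pos hr.1]
      exact hr.2
  rw [← integral_toCircle_eq_circleAverage] at havg
  have hr0 : (r : ℂ) ^ p ≠ 0 := pow_ne_zero _ (Complex.ofReal_ne_zero.2 hr.1.ne')
  refine (mul_left_cancel₀ hr0 ?_).symm
  rw [mul_zero, ← integral_const_mul, ← havg]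
  refine integral_congr_ae (ae_of_all _ fun t => ?_)
  simp only [smul_eq_mul, mul_pow, fourier_apply, natCast_zsmul, AddCircle.toCircle_nsmul,
    Circle.coe_pow, mul_assoc]

end Inner

/-! ### Sums of ranges of commuting idempotents. -/

section CommutingProjections

/-- The sum of the ranges of finitely many commuting continuous idempotents is closed. -/
lemma isClosed_iSup_range_of_commute {E ι : Type*} [NormedAddCommGroup E] [NormedSpace ℂ E]
    [Fintype ι] (P : ι → E →L[ℂ] E) (hP : ∀ i, P i * P i = P i)
    (hcomm : ∀ i j, Commute (P i) (P j)) :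
    IsClosed ((⨆ i, LinearMap.range (P i).toLinearMap : Submodule ℂ E) : Set E) := by
  classical
  -- `Q` is the product of the 1 - Pᵢ over `s`. The first property puts its kernel inside the sum of
  -- ranges; the second, for `s` everything, gives the reverse inclusion.
  have key : ∀ s : Finset ι, ∃ Q : E →L[ℂ] E,
      (∀ x, x - Q x ∈ ⨆ i, LinearMap.range (P i).toLinearMap) ∧ (∀ i ∈ s, Q * P i = 0) ∧
        ∀ i, Commute Q (P i) := by
    intro s
    induction s using Finset.induction_on with
    | empty => exact ⟨1, by simp, by simp, fun i => Commute.one_left _⟩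
    | insert a s _ ih =>
      obtain ⟨Q, h1, h2, h3⟩ := ih
      refine ⟨(1 - P a) * Q, fun x => ?_, fun i hi => ?_, fun i => ?_⟩
      · have : x - ((1 - P a) * Q) x = (x - Q x) + P a (Q x) := by
          change x - (Q x - P a (Q x)) = _
          abel
        rw [this]
        exact add_mem (h1 x)
          (Submodule.mem_iSup_of_mem a (LinearMap.mem_range_self (P a).toLinearMap (Q x)))
      · rcases Finset.mem_insert.1 hi with rfl | hi
        · rw [mul_assoc, (h3 i).eq, ← mul_assoc, sub_mul, one_mul, hP, sub_self, zero_mul]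
        · rw [mul_assoc, h2 i hi, mul_zero]
      · exact ((Commute.one_left _).sub_left (hcomm a i)).mul_left (h3 i)
  obtain ⟨Q, h1, h2, -⟩ := key Finset.univ
  have : (⨆ i, LinearMap.range (P i).toLinearMap : Submodule ℂ E) =
      LinearMap.ker Q.toLinearMap := by
    refine le_antisymm (iSup_le fun i => ?_) fun x hx => ?_
    · rintro _ ⟨y, rfl⟩
      exact DFunLike.congr_fun (h2 i (Finset.mem_univ i)) y
    · have h := h1 x
      rwa [show Q x = 0 from hx, sub_zero] at h
  rw [this]
  exact Q.isClosed_ker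

end CommutingProjections

/-! ### The sums of inner multiples are closed and invariant. -/

section Submodules

variable {n : ℕ}

lemma mulOp_comp_eval_mem_hardySpace {ψ : UnitAddCircle → ℂ}
    (hψ : IsUnimodular AddCircle.haarAddCircle ψ) (hneg : ∀ m < 0, fourierCoeff ψ m = 0)
    (j : Fin n) {f : L2 n} (hf : f ∈ hardySpace n) :
    mulOp (hψ.comp_eval j) f ∈ hardySpace n := by
  rw [mem_hardySpace_iff] at hf ⊢
  rintro k ⟨i, hi⟩
  refine coeff_mulOp_comp_eval_eq_zero hψ j f k fun l hl => ?_
  by_cases hij : i = j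
  · subst hij
    rcases lt_or_ge (l i) 0 with h | h
    · exact Or.inr (hf l ⟨i, h⟩)
    · exact Or.inl (hneg _ (by omega))
  · exact Or.inr (hf l ⟨i, by rwa [hl i hij]⟩)

/-- The i-th index is untouched by a function of zⱼ, even one with negative frequencies such as
Θ̄ⱼ(zⱼ). -/
lemma coeff_mulOp_comp_eval_of_ne {ψ : UnitAddCircle → ℂ}
    (hψ : IsUnimodular AddCircle.haarAddCircle ψ) {i j : Fin n} (hij : i ≠ j) {f : L2 n}
    (hf : f ∈ hardySpace n) {k : Fin n → ℤ} (hk : k i < 0) :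
    coeff k (mulOp (hψ.comp_eval j) f) = 0 :=
  coeff_mulOp_comp_eval_eq_zero hψ j f k fun l hl =>
    Or.inr (mem_hardySpace_iff.1 hf l ⟨i, by rwa [hl i hij]⟩)

lemma isUnimodular_toCircle :
    IsUnimodular AddCircle.haarAddCircle fun s : UnitAddCircle => (AddCircle.toCircle s : ℂ) :=
  ⟨(continuous_subtype_val.comp AddCircle.continuous_toCircle).aestronglyMeasurable,
    ae_of_all _ fun _ => Circle.norm_coe _⟩

lemma fourierCoeff_toCircle {m : ℤ} (hm : m < 0) :
    fourierCoeff (fun s : UnitAddCircle => (AddCircle.toCircle s : ℂ)) m = 0 := by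
  have h := orthonormal_iff_ite.1 (orthonormal_fourier (T := 1)) m 1
  rw [if_neg (by omega), ContinuousMap.inner_toLp] at h
  rw [← h, fourierCoeff]
  refine integral_congr_ae (ae_of_all _ fun s => ?_)
  simp only [fourier_one, smul_eq_mul]
  rw [← fourier_neg, mul_comm]

lemma coordMul_mem_hardySpace (i : Fin n) {f : L2 n} (hf : f ∈ hardySpace n) :
    coordMul i f ∈ hardySpace n :=
  -- `coordMul i` agrees by definition with `mulOp` for the function `toCircle` of the i-th
  -- coordinate.
  mulOp_comp_eval_mem_hardySpace isUnimodular_toCircle (fun _ => fourierCoeff_toCircle) i hf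

variable {θ χ : ℂ → ℂ}

/-- Multiplication by `θ(zᵢ)` for an inner function `θ`. -/
def innerMul (hθ : IsInner θ) (i : Fin n) : L2 n →L[ℂ] L2 n :=
  mulOp (hθ.isUnimodular.comp_eval i)

/-- Multiplication by the conjugate of `θ(zᵢ)` for an inner function `θ`. -/
def innerMulConj (hθ : IsInner θ) (i : Fin n) : L2 n →L[ℂ] L2 n :=
  mulOp (hθ.isUnimodular.conj.comp_eval i)

lemma innerMulConj_innerMul (hθ : IsInner θ) (i : Fin n) (f : L2 n) :
    innerMulConj hθ i (innerMul hθ i f) = f :=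
  mulOp_conj_mulOp _ f

lemma mem_innerMultiples_iff (hθ : IsInner θ) {i : Fin n} {f : L2 n} :
    f ∈ innerMultiples θ i ↔ ∃ h ∈ hardySpace n, innerMul hθ i h = f := by
  refine exists_congr fun h => and_congr_right fun _ => ⟨fun hf => ?_, fun hf => ?_⟩
  · exact Lp.ext ((coeFn_mulOp _ h).trans hf.symm)
  · rw [← hf]
    exact coeFn_mulOp _ h

lemma innerMul_mem_hardySpace (hθ : IsInner θ) (i : Fin n) {f : L2 n} (hf : f ∈ hardySpace n) :
    innerMul hθ i f ∈ hardySpace n :=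
  mulOp_comp_eval_mem_hardySpace hθ.isUnimodular (fun _ => hθ.fourierCoeff_eq_zero) i hf

lemma innerMultiples_le_hardySpace (hθ : IsInner θ) (i : Fin n) :
    innerMultiples θ i ≤ hardySpace n := by
  intro f hf
  obtain ⟨h, hh, rfl⟩ := (mem_innerMultiples_iff hθ).1 hf
  exact innerMul_mem_hardySpace hθ i hh

/-- Multiplication by θ(zᵢ) preserves H², so its adjoint, multiplication by the conjugate, preserves
the orthogonal complement of H². -/
lemma starProjection_innerMulConj_starProjection (hθ : IsInner θ) (i : Fin n) (f : L2 n) :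
    (hardySpace n).starProjection (innerMulConj hθ i ((hardySpace n).starProjection f)) =
      (hardySpace n).starProjection (innerMulConj hθ i f) := by
  rw [← sub_eq_zero, ← map_sub, ← map_sub, Submodule.starProjection_apply_eq_zero_iff,
    Submodule.mem_orthogonal]
  intro h hh
  have h1 := inner_mulOp_right (hθ.isUnimodular.comp_eval i).conj h
    ((hardySpace n).starProjection f - f)
  refine h1.trans ?_
  have h2 : mulOp (hθ.isUnimodular.comp_eval i).conj.conj h = innerMul hθ i h := by
    refine Lp.ext ?_
    filter_upwards [coeFn_mulOp (hθ.isUnimodular.comp_eval i).conj.conj h,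
      coeFn_mulOp (hθ.isUnimodular.comp_eval i) h] with t h3 h4
    rw [h3, Complex.conj_conj]
    exact h4.symm
  rw [h2, ← neg_sub, inner_neg_right, neg_eq_zero]
  exact Submodule.mem_orthogonal _ _ |>.1 (Submodule.sub_starProjection_mem_orthogonal f) _
    (innerMul_mem_hardySpace hθ i hh)

lemma coeff_starProjection_of_nonneg (f : L2 n) {k : Fin n → ℤ} (hk : ∀ i, 0 ≤ k i) :
    coeff k ((hardySpace n).starProjection f) = coeff k f := by
  have hmem : character k ∈ hardySpace n := by
    refine mem_hardySpace_iff.2 fun l hl => (coeff_character l k).trans (if_neg ?_)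
    rintro rfl
    obtain ⟨i, hi⟩ := hl
    exact absurd (hk i) (not_le.2 hi)
  rw [← sub_eq_zero, ← map_sub, ← neg_sub, map_neg, neg_eq_zero]
  exact Submodule.mem_orthogonal _ _ |>.1 (Submodule.sub_starProjection_mem_orthogonal f) _ hmem

/-- For h in H², the part of θ̄(zᵢ)h removed by the projection has a negative i-th index, and
multiplication by χ(zⱼ) keeps that index negative. -/
lemma starProjection_innerMulConj_innerMul (hθ : IsInner θ) (hχ : IsInner χ) {i j : Fin n}
    (hij : i ≠ j) {h : L2 n} (hh : h ∈ hardySpace n) :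
    (hardySpace n).starProjection (innerMulConj hθ i (innerMul hχ j h)) =
      innerMul hχ j ((hardySpace n).starProjection (innerMulConj hθ i h)) := by
  have hcomm : innerMulConj hθ i (innerMul hχ j h) = innerMul hχ j (innerMulConj hθ i h) :=
    mulOp_comm _ _ h
  set a := innerMulConj hθ i h with ha
  have hmem : innerMul hχ j ((hardySpace n).starProjection a) ∈ hardySpace n :=
    innerMul_mem_hardySpace hχ j (Submodule.starProjection_apply_mem _ a)
  rw [hcomm, ← Submodule.starProjection_eq_self_iff.2 hmem, ← sub_eq_zero, ← map_sub, ← map_sub]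
  refine starProjection_hardySpace_eq_zero fun k hk => ?_
  refine coeff_mulOp_comp_eval_eq_zero hχ.isUnimodular j _ k fun l hl => Or.inr ?_
  rw [map_sub, sub_eq_zero]
  rcases lt_or_ge (l j) 0 with hlj | hlj
  -- A negative j-th index occurs neither in `a` nor in its projection; otherwise all indices of `l`
  -- are nonnegative and the projection keeps the coefficient.
  · rw [mem_hardySpace_iff.1 (Submodule.starProjection_apply_mem _ a) l ⟨j, hlj⟩]
    exact coeff_mulOp_comp_eval_of_ne hθ.isUnimodular.conj hij.symm hh hlj
  · refine (coeff_starProjection_of_nonneg a fun m => ?_).symm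
    by_cases hm : m = j
    · rwa [hm]
    · rw [hl m hm]
      exact hk m

/-- The orthogonal projection of `L²(𝕋ⁿ)` onto `θ(zᵢ) H²(𝔻ⁿ)`. -/
def innerProj (hθ : IsInner θ) (i : Fin n) : L2 n →L[ℂ] L2 n :=
  innerMul hθ i ∘L (hardySpace n).starProjection ∘L innerMulConj hθ i ∘L
    (hardySpace n).starProjection

lemma innerProj_apply (hθ : IsInner θ) (i : Fin n) (f : L2 n) :
    innerProj hθ i f = innerMul hθ i ((hardySpace n).starProjection
      (innerMulConj hθ i ((hardySpace n).starProjection f))) := rfl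

lemma innerProj_apply_of_mem (hθ : IsInner θ) {i : Fin n} {f : L2 n}
    (hf : f ∈ innerMultiples θ i) : innerProj hθ i f = f := by
  rw [innerProj_apply,
    Submodule.starProjection_eq_self_iff.2 (innerMultiples_le_hardySpace hθ i hf)]
  obtain ⟨h, hh, rfl⟩ := (mem_innerMultiples_iff hθ).1 hf
  rw [innerMulConj_innerMul, Submodule.starProjection_eq_self_iff.2 hh]

lemma innerProj_mem (hθ : IsInner θ) (i : Fin n) (f : L2 n) :
    innerProj hθ i f ∈ innerMultiples θ i :=
  (mem_innerMultiples_iff hθ).2 ⟨_, Submodule.starProjection_apply_mem _ _, rfl⟩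

lemma range_innerProj (hθ : IsInner θ) (i : Fin n) :
    LinearMap.range (innerProj hθ i).toLinearMap = innerMultiples θ i := by
  refine le_antisymm ?_ fun f hf => ⟨f, innerProj_apply_of_mem hθ hf⟩
  rintro _ ⟨f, rfl⟩
  exact innerProj_mem hθ i f

/-- The right-hand side is symmetric in the two pairs up to commuting multiplications, which yields
`commute_innerProj`. -/
lemma innerProj_comp_apply (hθ : IsInner θ) (hχ : IsInner χ) {i j : Fin n} (hij : i ≠ j)
    (f : L2 n) :
    innerProj hθ i (innerProj hχ j f) = innerMul hθ i (innerMul hχ j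
      ((hardySpace n).starProjection (innerMulConj hθ i (innerMulConj hχ j
        ((hardySpace n).starProjection f))))) := by
  rw [innerProj_apply hθ, Submodule.starProjection_eq_self_iff.2
    (innerMultiples_le_hardySpace hχ j (innerProj_mem hχ j f)), innerProj_apply,
    starProjection_innerMulConj_innerMul hθ hχ hij (Submodule.starProjection_apply_mem _ _),
    starProjection_innerMulConj_starProjection]

lemma commute_innerProj (hθ : IsInner θ) (hχ : IsInner χ) {i j : Fin n} (hij : i ≠ j) :
    Commute (innerProj hθ i) (innerProj hχ j) := by
  refine ContinuousLinearMap.ext fun f => ?_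
  refine (innerProj_comp_apply hθ hχ hij f).trans
    (Eq.trans ?_ (innerProj_comp_apply hχ hθ hij.symm f).symm)
  have h1 (g : L2 n) : innerMul hθ i (innerMul hχ j g) = innerMul hχ j (innerMul hθ i g) :=
    mulOp_comm _ _ g
  have h2 (g : L2 n) :
      innerMulConj hθ i (innerMulConj hχ j g) = innerMulConj hχ j (innerMulConj hθ i g) :=
    mulOp_comm _ _ g
  rw [h1, h2]

lemma isHardySubmodule_innerSum {Θ : Fin n → ℂ → ℂ} (hΘ : ∀ i, IsInner (Θ i)) :
    IsHardySubmodule (innerSum Θ) where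
  le_hardySpace := iSup_le fun i => innerMultiples_le_hardySpace (hΘ i) i
  isClosed := by
    have h := isClosed_iSup_range_of_commute (fun i => innerProj (hΘ i) i)
      (fun i => ContinuousLinearMap.ext fun f =>
        innerProj_apply_of_mem (hΘ i) (innerProj_mem (hΘ i) i f))
      (fun i j => by
        by_cases hij : i = j
        · subst hij
          exact Commute.refl _
        · exact commute_innerProj (hΘ i) (hΘ j) hij)
    simp only [range_innerProj] at h
    exact h
  coordMul_mem i f hf := by
    have hle : innerSum Θ ≤ (innerSum Θ).comap (coordMul i) := by
      refine iSup_le fun j f hf => Submodule.mem_iSup_of_mem j ?_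
      obtain ⟨h, hh, rfl⟩ := (mem_innerMultiples_iff (hΘ j)).1 hf
      exact (mem_innerMultiples_iff (hΘ j)).2
        ⟨coordMul i h, coordMul_mem_hardySpace i hh,
          mulOp_comm _ (isUnimodular_toCircle.comp_eval i) h⟩
    exact hle hf

end Submodules

/-! ### Unitary module maps and their multipliers. -/

section UnitaryEquivalence

variable {n : ℕ}

lemma isUnimodular_mFourier (k : Fin n → ℤ) :
    IsUnimodular (torusMeasure n) (UnitAddTorus.mFourier k) where
  aestronglyMeasurable := (UnitAddTorus.mFourier k).continuous.aestronglyMeasurable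
  norm_eq_one := ae_of_all _ fun t => by
    simp only [UnitAddTorus.mFourier, ContinuousMap.coe_mk, norm_prod, fourier_apply,
      Circle.norm_coe, Finset.prod_const_one]

/-- Multiplication by the character `z ^ k`. -/
def charMul (k : Fin n → ℤ) : L2 n →L[ℂ] L2 n := mulOp (isUnimodular_mFourier k)

lemma charMul_zero (f : L2 n) : charMul 0 f = f := by
  refine Lp.ext ?_
  filter_upwards [coeFn_mulOp (isUnimodular_mFourier 0) f] with t ht
  refine ht.trans ?_
  rw [UnitAddTorus.mFourier_zero, ContinuousMap.one_apply, one_mul]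

lemma charMul_add (k l : Fin n → ℤ) (f : L2 n) : charMul (k + l) f = charMul k (charMul l f) := by
  refine Lp.ext ?_
  filter_upwards [coeFn_mulOp (isUnimodular_mFourier (k + l)) f,
    coeFn_mulOp (isUnimodular_mFourier k) (charMul l f),
    coeFn_mulOp (isUnimodular_mFourier l) f] with t h1 h2 h3
  refine h1.trans (Eq.trans ?_ h2.symm)
  rw [UnitAddTorus.mFourier_add, mul_assoc]
  exact congrArg _ h3.symm

lemma charMul_single (i : Fin n) (f : L2 n) : charMul (Pi.single i 1) f = coordMul i f := by
  refine Lp.ext ?_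
  filter_upwards [coeFn_mulOp (isUnimodular_mFourier (Pi.single i 1)) f,
    coeFn_mulOp (isUnimodular_toCircle.comp_eval i) f] with t h1 h2
  refine h1.trans (Eq.trans ?_ h2.symm)
  rw [UnitAddTorus.mFourier_single, fourier_one]

variable {S S' : Submodule ℂ (L2 n)}

/-- The exponents for which S is stable and U intertwines form an additive submonoid of ℕⁿ
containing the unit vectors. -/
lemma charMul_natCast_mem_and_map (hS : ∀ i, ∀ f ∈ S, coordMul i f ∈ S) (U : S ≃ₗᵢ[ℂ] S')
    (hU : ∀ (i : Fin n) (f g : S), (g : L2 n) = coordMul i (f : L2 n) →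
      (U g : L2 n) = coordMul i (U f : L2 n)) (k : Fin n → ℕ) (f : S) :
    ∃ g : S, (g : L2 n) = charMul (fun i => (k i : ℤ)) f ∧
      (U g : L2 n) = charMul (fun i => (k i : ℤ)) (U f) := by
  let M : AddSubmonoid (Fin n → ℕ) :=
    { carrier := {k | ∀ f : S, ∃ g : S, (g : L2 n) = charMul (fun i => (k i : ℤ)) f ∧
        (U g : L2 n) = charMul (fun i => (k i : ℤ)) (U f)}
      zero_mem' := fun f => ⟨f, (charMul_zero _).symm, (charMul_zero _).symm⟩
      add_mem' := by
        intro k l hk hl f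
        obtain ⟨g, hg, hg'⟩ := hl f
        obtain ⟨h, hh, hh'⟩ := hk g
        have : (fun i => (((k + l) i : ℕ) : ℤ)) = (fun i => (k i : ℤ)) + fun i => (l i : ℤ) :=
          funext fun i => Nat.cast_add _ _
        refine ⟨h, ?_, ?_⟩
        · rw [this, charMul_add, hh, hg]
        · rw [this, charMul_add, hh', hg'] }
  have hsingle : ∀ i, Pi.single i 1 ∈ M := fun i f => by
    have : (fun j => ((Pi.single i 1 : Fin n → ℕ) j : ℤ)) = Pi.single i 1 := by
      funext j
      by_cases hj : j = i
      · subst hj; simp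
      · simp [hj]
    refine ⟨⟨coordMul i f, hS i f f.2⟩, ?_, ?_⟩
    · rw [this, charMul_single]
    · rw [this, charMul_single]
      exact hU i f _ rfl
  have hk : k ∈ M := by
    have : k = ∑ i, k i • (Pi.single i 1 : Fin n → ℕ) := by
      refine (pi_eq_sum_univ' k).trans (Finset.sum_congr rfl fun i _ => ?_)
      funext j
      simp [Pi.single_apply]
    rw [this]
    exact AddSubmonoid.sum_mem _ fun i _ => AddSubmonoid.nsmul_mem _ (hsingle i) _
  exact hk f

/-- Expresses any Fourier coefficient of g̅ f through nonnegative powers only, the ones a module map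
respects. -/
lemma integral_mFourier_mul_conj_mul (a b : Fin n → ℕ) (f g : L2 n) :
    ∫ t, UnitAddTorus.mFourier (fun i => (a i : ℤ) - b i) t * (conj (g t) * f t) ∂torusMeasure n =
      inner ℂ (charMul (fun i => (b i : ℤ)) g) (charMul (fun i => (a i : ℤ)) f) := by
  rw [L2.inner_def]
  refine integral_congr_ae ?_
  filter_upwards [coeFn_mulOp (isUnimodular_mFourier fun i => (b i : ℤ)) g,
    coeFn_mulOp (isUnimodular_mFourier fun i => (a i : ℤ)) f] with t h1 h2
  rw [charMul, charMul, h1, h2, RCLike.inner_apply, map_mul, ← UnitAddTorus.mFourier_neg]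
  have : (fun i => (a i : ℤ) - b i) = (fun i => (a i : ℤ)) + -fun i => (b i : ℤ) :=
    funext fun i => sub_eq_add_neg _ _
  rw [this, UnitAddTorus.mFourier_add]
  ring

lemma integrable_conj_mul (f g : L2 n) :
    Integrable (fun t => conj (g t) * f t) (torusMeasure n) := by
  refine (L2.integrable_inner (𝕜 := ℂ) g f).congr (ae_of_all _ fun t => ?_)
  exact (RCLike.inner_apply _ _).trans (mul_comm _ _)

/-- A unitary module map preserves the pointwise products `g̅ f`. -/
lemma conj_mul_ae_eq_of_unitary (hS : ∀ i, ∀ f ∈ S, coordMul i f ∈ S) (U : S ≃ₗᵢ[ℂ] S')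
    (hU : ∀ (i : Fin n) (f g : S), (g : L2 n) = coordMul i (f : L2 n) →
      (U g : L2 n) = coordMul i (U f : L2 n)) (f g : S) :
    (fun t => conj ((g : L2 n) t) * (f : L2 n) t) =ᵐ[torusMeasure n]
      fun t => conj ((U g : L2 n) t) * (U f : L2 n) t := by
  refine ae_eq_of_integral_mFourier_mul_eq (integrable_conj_mul _ _) (integrable_conj_mul _ _)
    fun k => ?_
  -- Split `k` into positive and negative parts; the negative part acts on `g`.
  have hk : k = fun i => ((k i).toNat : ℤ) - ((-k i).toNat : ℤ) := by
    funext i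
    omega
  rw [hk, integral_mFourier_mul_conj_mul (fun i => (k i).toNat) (fun i => (-k i).toNat),
    integral_mFourier_mul_conj_mul (fun i => (k i).toNat) (fun i => (-k i).toNat)]
  obtain ⟨f', hf, hf'⟩ := charMul_natCast_mem_and_map hS U hU (fun i => (k i).toNat) f
  obtain ⟨g', hg, hg'⟩ := charMul_natCast_mem_and_map hS U hU (fun i => (-k i).toNat) g
  rw [← hf, ← hg, ← hf', ← hg', ← Submodule.coe_inner, ← Submodule.coe_inner,
    U.inner_map_map]

lemma symm_intertwines (hS : ∀ i, ∀ f ∈ S, coordMul i f ∈ S) (U : S ≃ₗᵢ[ℂ] S')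
    (hU : ∀ (i : Fin n) (f g : S), (g : L2 n) = coordMul i (f : L2 n) →
      (U g : L2 n) = coordMul i (U f : L2 n)) (i : Fin n) (f g : S')
    (hfg : (g : L2 n) = coordMul i (f : L2 n)) :
    (U.symm g : L2 n) = coordMul i (U.symm f : L2 n) := by
  have h1 := hU i (U.symm f) ⟨coordMul i (U.symm f), hS i _ (U.symm f).2⟩ rfl
  rw [U.apply_symm_apply, ← hfg, SetLike.coe_eq_coe] at h1
  rw [← h1, U.symm_apply_apply]

lemma UnitarilyEquivalent.symm (hS : ∀ i, ∀ f ∈ S, coordMul i f ∈ S)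
    (h : UnitarilyEquivalent S S') : UnitarilyEquivalent S' S := by
  obtain ⟨U, hU⟩ := h
  exact ⟨U.symm, symm_intertwines hS U hU⟩

/-- The element `θ(zᵢ)` of `θ(zᵢ) H²(𝔻ⁿ)`. -/
lemma innerMul_character_zero_mem {θ : ℂ → ℂ} (hθ : IsInner θ) (i : Fin n) :
    innerMul hθ i (character 0) ∈ innerMultiples θ i := by
  refine (mem_innerMultiples_iff hθ).2 ⟨_, mem_hardySpace_iff.2 fun k hk => ?_, rfl⟩
  refine (coeff_character k 0).trans (if_neg ?_)
  rintro rfl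
  obtain ⟨j, hj⟩ := hk
  exact lt_irrefl _ hj

lemma coeFn_innerMul_character_zero {θ : ℂ → ℂ} (hθ : IsInner θ) (i : Fin n) :
    innerMul hθ i (character 0) =ᵐ[torusMeasure n] fun t => boundaryValue θ (t i) := by
  filter_upwards [coeFn_mulOp (hθ.isUnimodular.comp_eval i) (character 0),
    coeFn_character (0 : Fin n → ℤ)] with t h1 h2
  refine h1.trans ?_
  rw [h2, UnitAddTorus.mFourier_zero, ContinuousMap.one_apply, mul_one]

lemma norm_eq_one_of_conj_mul_self {z : ℂ} (h : conj z * z = 1) : ‖z‖ = 1 := by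
  rw [← Complex.normSq_eq_conj_mul_self, Complex.normSq_eq_norm_sq] at h
  exact (pow_eq_one_iff_of_nonneg (norm_nonneg z) two_ne_zero).1 (by exact_mod_cast h)

/-- A unitary module map on `∑ᵢ Θᵢ(zᵢ) H²(𝔻ⁿ)` with values in the Hardy space is multiplication by a
unimodular function in the Hardy space. -/
lemma exists_multiplier (hn : 2 ≤ n) {Θ : Fin n → ℂ → ℂ} (hΘ : ∀ i, IsInner (Θ i))
    (hS' : S' ≤ hardySpace n) (U : innerSum Θ ≃ₗᵢ[ℂ] S')
    (hU : ∀ (i : Fin n) (f g : innerSum Θ), (g : L2 n) = coordMul i (f : L2 n) →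
      (U g : L2 n) = coordMul i (U f : L2 n)) :
    ∃ φ ∈ hardySpace n, (∀ᵐ t ∂torusMeasure n, ‖φ t‖ = 1) ∧
      ∀ f : innerSum Θ, (U f : L2 n) =ᵐ[torusMeasure n] fun t => φ t * (f : L2 n) t := by
  let u : Fin n → innerSum Θ := fun i =>
    ⟨innerMul (hΘ i) i (character 0),
      Submodule.mem_iSup_of_mem i (innerMul_character_zero_mem (hΘ i) i)⟩
  have hprod := conj_mul_ae_eq_of_unitary (isHardySubmodule_innerSum hΘ).coordMul_mem U hU
  -- Since U should be multiplication by φ, dividing UΘᵢ by the unimodular Θᵢ recovers φ.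
  let φ : Fin n → L2 n := fun i => innerMulConj (hΘ i) i (U (u i))
  have hu1 (i : Fin n) : ∀ᵐ t ∂torusMeasure n, conj ((u i : L2 n) t) * (u i : L2 n) t = 1 := by
    filter_upwards [coeFn_innerMul_character_zero (hΘ i) i,
      ((hΘ i).isUnimodular.comp_eval i).norm_eq_one] with t h1 h2
    change conj (innerMul (hΘ i) i (character 0) t) * innerMul (hΘ i) i (character 0) t = 1
    rw [h1, ← Complex.normSq_eq_conj_mul_self, Complex.normSq_eq_norm_sq, h2]
    simp
  have hφ (i : Fin n) : φ i =ᵐ[torusMeasure n]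
      fun t => conj ((u i : L2 n) t) * (U (u i) : L2 n) t := by
    filter_upwards [coeFn_innerMul_character_zero (hΘ i) i,
      coeFn_mulOp ((hΘ i).isUnimodular.conj.comp_eval i) (U (u i))] with t h1 h2
    refine h2.trans ?_
    change _ = conj (innerMul (hΘ i) i (character 0) t) * _
    rw [h1]
  have hmul (i : Fin n) (f : innerSum Θ) :
      (U f : L2 n) =ᵐ[torusMeasure n] fun t => φ i t * (f : L2 n) t := by
    filter_upwards [hφ i, hprod f (u i), hprod (u i) (u i), hu1 i] with t h1 h2 h3 h4
    rw [h1, mul_right_comm, h2, mul_right_comm, ← h3, h4, one_mul]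
  have hφeq (i j : Fin n) : φ i = φ j := by
    refine Lp.ext ?_
    filter_upwards [hmul i (u i), hmul j (u i), hu1 i] with t h1 h2 h3
    have h0 : (u i : L2 n) t ≠ 0 := right_ne_zero_of_mul (h3.symm ▸ one_ne_zero)
    exact mul_right_cancel₀ h0 (h1.symm.trans h2)
  let i₀ : Fin n := ⟨0, by omega⟩
  refine ⟨φ i₀, mem_hardySpace_iff.2 ?_, ?_, hmul i₀⟩
  · rintro k ⟨i, hi⟩
    -- This is where n ≥ 2 enters: φ is computed from an index j other than the direction i in which
    -- the frequency is negative.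
    obtain ⟨j, hj⟩ : ∃ j : Fin n, i ≠ j := by
      have : Nontrivial (Fin n) := Fin.nontrivial_iff_two_le.2 hn
      exact (exists_ne i).imp fun _ => Ne.symm
    rw [hφeq i₀ j]
    exact coeff_mulOp_comp_eval_of_ne (hΘ j).isUnimodular.conj hj (hS' (U (u j)).2) hi
  · filter_upwards [hφ i₀, hprod (u i₀) (u i₀), hu1 i₀] with t h1 h2 h3
    rw [h1, norm_mul, RCLike.norm_conj, norm_eq_one_of_conj_mul_self h3,
      norm_eq_one_of_conj_mul_self (h2.symm.trans h3), one_mul]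

lemma coeff_eq_conj_coeff_neg {f g : L2 n}
    (h : g =ᵐ[torusMeasure n] fun t => conj (f t)) (k : Fin n → ℤ) :
    coeff k g = conj (coeff (-k) f) := by
  rw [coeff_eq_integral, coeff_eq_integral, ← integral_conj]
  refine integral_congr_ae ?_
  filter_upwards [h] with t ht
  rw [ht, map_mul, UnitAddTorus.mFourier_neg, Complex.conj_conj]

/-- If `φ` and `φ̅` belong to the Hardy space, then `φ` is constant. -/
lemma eq_smul_character_zero {φ φ' : L2 n} (hφ : φ ∈ hardySpace n) (hφ' : φ' ∈ hardySpace n)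
    (h : φ' =ᵐ[torusMeasure n] fun t => conj (φ t)) :
    φ = coeff 0 φ • character 0 := by
  refine ext_coeff fun k => ?_
  rw [map_smul, coeff_character, smul_eq_mul]
  split_ifs with hk
  · rw [hk, mul_one]
  · rw [mul_zero]
    obtain ⟨i, hi⟩ := Function.ne_iff.1 hk
    rcases lt_or_gt_of_ne hi with hi | hi
    · exact mem_hardySpace_iff.1 hφ k ⟨i, hi⟩
    · have h1 := mem_hardySpace_iff.1 hφ' (-k) ⟨i, neg_lt_zero.2 hi⟩
      rwa [coeff_eq_conj_coeff_neg h, neg_neg, map_eq_zero] at h1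

lemma innerSum_le_of_unitarilyEquivalent (hn : 2 ≤ n) {Θ Φ : Fin n → ℂ → ℂ}
    (hΘ : ∀ i, IsInner (Θ i)) (hΦ : ∀ i, IsInner (Φ i))
    (h : UnitarilyEquivalent (innerSum Θ) (innerSum Φ)) : innerSum Θ ≤ innerSum Φ := by
  have hSΘ := isHardySubmodule_innerSum hΘ
  have hSΦ := isHardySubmodule_innerSum hΦ
  obtain ⟨U, hU⟩ := h
  obtain ⟨φ, hφ, hφ1, hUφ⟩ := exists_multiplier hn hΘ hSΦ.le_hardySpace U hU
  obtain ⟨φ', hφ', -, hVφ⟩ := exists_multiplier hn hΦ hSΘ.le_hardySpace U.symm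
    (symm_intertwines hSΘ.coordMul_mem U hU)
  let i : Fin n := ⟨0, by omega⟩
  let u : innerSum Θ := ⟨innerMul (hΘ i) i (character 0),
    Submodule.mem_iSup_of_mem i (innerMul_character_zero_mem (hΘ i) i)⟩
  have hconj : φ' =ᵐ[torusMeasure n] fun t => conj (φ t) := by
    have h3 := hVφ (U u)
    rw [U.symm_apply_apply] at h3
    filter_upwards [hφ1, hUφ u, h3, coeFn_innerMul_character_zero (hΘ i) i,
      ((hΘ i).isUnimodular.comp_eval i).norm_eq_one] with t h1 h2 h3 h4 h5
    have h0 : (u : L2 n) t ≠ 0 := by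
      change innerMul (hΘ i) i (character 0) t ≠ 0
      rw [h4, ← norm_ne_zero_iff, h5]
      exact one_ne_zero
    -- Comparing U⁻¹U with the identity on Θᵢ(zᵢ), which has no zeros almost everywhere.
    have h6 : φ' t * φ t = 1 := by
      refine mul_right_cancel₀ h0 ?_
      rw [mul_assoc, ← h2, ← h3, one_mul]
    have h7 : conj (φ t) * φ t = 1 := by
      rw [← Complex.normSq_eq_conj_mul_self, Complex.normSq_eq_norm_sq, h1]
      simp
    exact mul_right_cancel₀ (right_ne_zero_of_mul_eq_one h6) (h6.trans h7.symm)
  have hconst := eq_smul_character_zero hφ hφ' hconj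
  set c := coeff 0 φ
  have hUc (f : innerSum Θ) : (U f : L2 n) = c • (f : L2 n) := by
    refine Lp.ext ?_
    have h2 : φ =ᵐ[torusMeasure n] fun _ => c := by
      rw [hconst]
      filter_upwards [Lp.coeFn_smul c (character (0 : Fin n → ℤ)),
        coeFn_character (0 : Fin n → ℤ)] with t h3 h4
      rw [h3, Pi.smul_apply, h4, UnitAddTorus.mFourier_zero, ContinuousMap.one_apply,
        smul_eq_mul, mul_one]
    filter_upwards [hUφ f, h2, Lp.coeFn_smul c (f : L2 n)] with t h3 h4 h5
    rw [h3, h4, h5, Pi.smul_apply, smul_eq_mul]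
  intro f hf
  -- If c = 0 then U = 0, and injectivity forces f = 0.
  by_cases hc : c = 0
  · have h1 := hUc ⟨f, hf⟩
    rw [hc, zero_smul, ZeroMemClass.coe_eq_zero, map_eq_zero_iff U U.injective] at h1
    rw [show f = 0 from congrArg Subtype.val h1]
    exact zero_mem _
  · have h1 := (innerSum Φ).smul_mem c⁻¹ (U ⟨f, hf⟩).2
    rwa [hUc, inv_smul_smul₀ hc] at h1

end UnitaryEquivalence

end HardyPolydisc

end

theorem mainTheorem5 (n : ℕ) (hn : 2 ≤ n) (Θ Φ : Fin n → ℂ → ℂ)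
    (hΘ : ∀ i, HardyPolydisc.IsInner (Θ i)) (hΦ : ∀ i, HardyPolydisc.IsInner (Φ i)) :
    HardyPolydisc.IsHardySubmodule (HardyPolydisc.innerSum Θ) ∧
    HardyPolydisc.IsHardySubmodule (HardyPolydisc.innerSum Φ) ∧
    (HardyPolydisc.UnitarilyEquivalent (HardyPolydisc.innerSum Θ) (HardyPolydisc.innerSum Φ) ↔
      HardyPolydisc.innerSum Θ = HardyPolydisc.innerSum Φ) := by
  have hSΘ := HardyPolydisc.isHardySubmodule_innerSum hΘ
  refine ⟨hSΘ, HardyPolydisc.isHardySubmodule_innerSum hΦ, fun h => ?_, fun h => ?_⟩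
  · exact le_antisymm (HardyPolydisc.innerSum_le_of_unitarilyEquivalent hn hΘ hΦ h)
      (HardyPolydisc.innerSum_le_of_unitarilyEquivalent hn hΦ hΘ (h.symm hSΘ.coordMul_mem))
  · rw [← h]
    exact ⟨LinearIsometryEquiv.refl ℂ _, fun _ _ _ hfg => hfg⟩
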